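/- Let $\mathbb{F}$ be a field of characteristic zero, let $n \geq 0$, and let $\mathbf{d} = (d_1,\dots,d_n)$ be a sequence of nonnegative integers. Let $I_{\mathbf{d}} = (x_1^{d_1+1},\dots,x_n^{d_n+1},\,x_1+\cdots+x_n) \subseteq \mathbb{F}[x_1,\dots,x_n]$ and $R_{\mathbf{d}} = \mathbb{F}[x_1,\dots,x_n]/I_{\mathbf{d}}$. Order monomials lexicographically: $x_1^{a_1}\cdots x_n^{a_n} \prec x_1^{b_1}\cdots x_n^{b_n}$ if there is an $i$ with $a_j = b_j$ for all $j<i$ and $a_i<b_i$. A monomial is a standard monomial of $I_{\mathbf{d}}$ if it does not lie in the initial ideal of $I_{\mathbf{d}}$, that is, the ideal generated by the $\prec$-largest monomials $\mathrm{in}_\prec(f)$ of the nonzero $f \in I_{\mathbf{d}}$; the standard monomials descend to an $\mathbb{F}$-basis of $R_{\mathbf{d}}$, called its standard monomial basis. Let $\mathcal{T}_{\mathbf{d}}$ be the set of semistandard Young tableaux (rows weakly increasing, columns strictly increasing) of rectangular shape $2 \times m$ for some $m \geq 0$ (the empty tableau if $m=0$), with entries in $\{1,\dots,n\}$, which contain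 at most $d_i$ copies of $i$ for each $1 \leq i \leq n$. **Proposition.** The standard monomial basis of $R_{\mathbf{d}}$ with respect to the lexicographical order is $$\{\, x_1^{e_1}\cdots x_n^{e_n} \;:\; \text{there exists } T \in \mathcal{T}_{\mathbf{d}} \text{ with exactly } e_i \text{ copies of } i \text{ in its second row for all } 1 \leq i \leq n \,\}.$$ That is, this is exactly the set of standard monomials of $I_{\mathbf{d}}$, and distinct monomials in it have distinct images in $R_{\mathbf{d}}$ which form an $\mathbb{F}$-basis of $R_{\mathbf{d}}$. -/

import Mathlib

namespace OneRow

open MvPolynomial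

/-- The initial ideal of `I` with respect to the monomial order `m`: the ideal generated by the
leading monomials of the nonzero elements of `I`. -/
noncomputable def initialIdeal {σ F : Type*} [Field F] (m : MonomialOrder σ)
    (I : Ideal (MvPolynomial σ F)) : Ideal (MvPolynomial σ F) :=
  Ideal.span {g | ∃ f ∈ I, f ≠ 0 ∧ g = monomial (m.degree f) 1}

/-- The standard monomials of `I` with respect to `m`, given by their exponent vectors: the
monomials that do not lie in the initial ideal. -/
def standardMonomials {σ F : Type*} [Field F] (m : MonomialOrder σ)
    (I : Ideal (MvPolynomial σ F)) : Set (σ →₀ ℕ) :=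
  {e | (monomial e 1 : MvPolynomial σ F) ∉ initialIdeal m I}

/-- The ideal generated by the powers `x_i ^ (d_i + 1)` and by the sum of all the variables. -/
noncomputable def oneRowIdeal (F : Type*) [Field F] {n : ℕ} (d : Fin n → ℕ) :
    Ideal (MvPolynomial (Fin n) F) :=
  Ideal.span (Set.range (fun i : Fin n => (X i : MvPolynomial (Fin n) F) ^ (d i + 1)) ∪
    {∑ i : Fin n, X i})

/-- The quotient of the polynomial ring by `oneRowIdeal F d`. -/
abbrev OneRowRing (F : Type*) [Field F] {n : ℕ} (d : Fin n → ℕ) : Type _ :=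
  MvPolynomial (Fin n) F ⧸ oneRowIdeal F d

/-- The rectangular Young diagram with two rows of length `m` (empty if `m = 0`). -/
def twoRowRectangle (m : ℕ) : YoungDiagram where
  cells := Finset.range 2 ×ˢ Finset.range m
  isLowerSet := by
    rintro ⟨a, b⟩ ⟨a', b'⟩ ⟨h1, h2⟩ h
    simp only [Finset.coe_product, Finset.coe_range, Set.mem_prod, Set.mem_Iio] at h h1 h2 ⊢
    exact ⟨lt_of_le_of_lt h1 h.1, lt_of_le_of_lt h2 h.2⟩

/-- The number of copies of the letter `a` in the tableau `T`. -/
def copies {μ : YoungDiagram} (T : SemistandardYoungTableau μ) (a : ℕ) : ℕ :=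
  (μ.cells.filter (fun c => T c.1 c.2 = a)).card

/-- The number of copies of the letter `a` in row `r` (counted from `0`) of the tableau `T`. -/
def copiesInRow {μ : YoungDiagram} (T : SemistandardYoungTableau μ) (r a : ℕ) : ℕ :=
  ((μ.row r).filter (fun c => T c.1 c.2 = a)).card

/-- The semistandard tableaux of shape `2 × m` with entries in `{1, …, n}` and at most `d_i` copies
of each letter `i`. The letter of the index `i : Fin n` is `i + 1`. -/
def boundedTableaux {n : ℕ} (d : Fin n → ℕ) (m : ℕ) :
    Set (SemistandardYoungTableau (twoRowRectangle m)) :=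
  {T | (∀ c ∈ twoRowRectangle m, 1 ≤ T c.1 c.2 ∧ T c.1 c.2 ≤ n) ∧
    ∀ i : Fin n, copies T (i + 1) ≤ d i}

/-- The exponent vectors `(e_1, …, e_n)` for which some tableau in `boundedTableaux d m`, for some
`m`, has exactly `e_i` copies of `i` in its second row. -/
def secondRowExponents {n : ℕ} (d : Fin n → ℕ) : Set (Fin n →₀ ℕ) :=
  {e | ∃ m : ℕ, ∃ T ∈ boundedTableaux d m, ∀ i : Fin n, e i = copiesInRow T 1 (i + 1)}

end OneRow

/-! Write ℓ for the sum of the variables and D for the sum of the d_i. Exponents coming from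
tableaux are standard, and the exponents of `IsBallot`, which all come from tableaux, already span
the quotient. A spanning set of standard monomials contains every standard monomial, so all three
sets agree.

Standardness is apolarity. For a tableau with columns p over q, the polynomial f = ∏ (x_q - x_p) is
killed by ∑ ∂_i and has degree at most d_i in x_i, so the functional g ↦ (g(∂) f)(0) vanishes on the
ideal. The lex-smallest monomial of f is x^e, with e the content of the second row. An element of
the ideal with leading monomial x^e would share only that monomial with f and pair with it to a
nonzero scalar (`sum_single_mem_standardMonomials`).

Spanning goes by induction on n: modulo the powers of the variables, every form is a combination of
ℓ^j x^e with e ballot. The strong Lefschetz property, proved through an sl₂-action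
(`exists_sub_varSum_pow_mul_mem`), allows the restriction j ≤ D - 2|e|. This bound becomes the
ballot condition on a new last exponent when the old ℓ is traded for the new variable
(`mem_ballotSpan_succ`). Modulo ℓ only the terms with j = 0 survive.

Finally, a ballot exponent e gives a tableau by sorting the content e into the second row and d - e
into the first; the ballot inequality is strictness of the columns
(`IsBallot.mem_secondRowExponents`). -/

namespace OneRow

open MvPolynomial

/-! ### The strong Lefschetz property via sl₂ -/

section Lefschetz

variable {F : Type*} [Field F] {n : ℕ}

/-- The ideal generated by the powers `x_i ^ (d_i + 1)`. -/
noncomputable def powerIdeal (F : Type*) [Field F] {n : ℕ} (d : Fin n → ℕ) :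
    Ideal (MvPolynomial (Fin n) F) :=
  Ideal.span (Set.range fun i : Fin n => (X i : MvPolynomial (Fin n) F) ^ (d i + 1))

/-- The sum of all the variables. -/
noncomputable def varSum (F : Type*) [Field F] (n : ℕ) : MvPolynomial (Fin n) F :=
  ∑ i : Fin n, X i

theorem isHomogeneous_varSum : (varSum F n).IsHomogeneous 1 :=
  IsHomogeneous.sum _ _ _ fun i _ => isHomogeneous_X F i

/-- The operator `∑ i, d_i ∂_i - x_i ∂_i ^ 2`, which together with multiplication by the sum of the
variables generates an action of `sl₂`. -/
noncomputable def lowering (d : Fin n → ℕ) :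
    MvPolynomial (Fin n) F →ₗ[F] MvPolynomial (Fin n) F :=
  ∑ i : Fin n, ((d i : F) • (pderiv i).toLinearMap -
    LinearMap.mulLeft F (X i) ∘ₗ (pderiv i).toLinearMap ∘ₗ (pderiv i).toLinearMap)

theorem lowering_apply (d : Fin n → ℕ) (p : MvPolynomial (Fin n) F) :
    lowering d p = ∑ i : Fin n, ((d i : F) • pderiv i p - X i * pderiv i (pderiv i p)) := by
  simp [lowering, LinearMap.sum_apply]

theorem pderiv_varSum (i : Fin n) : pderiv i (varSum F n) = 1 := by
  classical
  simp [varSum, map_sum, pderiv_X, Pi.single_apply]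

/-- The sl₂ commutator relation: [lowering, ℓ] acts in degree k as the scalar D - 2k. -/
theorem lowering_varSum_mul (d : Fin n → ℕ) {k : ℕ} {p : MvPolynomial (Fin n) F}
    (hp : p.IsHomogeneous k) :
    lowering d (varSum F n * p) =
      varSum F n * lowering d p + (((∑ i, d i : ℕ) : F) - 2 * k) • p := by
  have h (i : Fin n) : (d i : F) • pderiv i (varSum F n * p) -
      X i * pderiv i (pderiv i (varSum F n * p)) =
      varSum F n * ((d i : F) • pderiv i p - X i * pderiv i (pderiv i p)) + (d i : F) • p -
        2 * (X i * pderiv i p) := by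
    simp only [pderiv_mul, pderiv_varSum, map_add, one_mul, smul_eq_C_mul]
    ring
  rw [lowering_apply, lowering_apply, Finset.sum_congr rfl fun i _ => h i, Finset.sum_sub_distrib,
    Finset.sum_add_distrib, ← Finset.mul_sum, ← Finset.mul_sum, hp.sum_X_mul_pderiv,
    ← Finset.sum_smul, sub_smul, mul_smul, Nat.cast_sum, add_sub_assoc]
  congr 2
  rw [smul_eq_C_mul, map_ofNat, nsmul_eq_mul, smul_eq_C_mul, map_natCast]

theorem lowering_isHomogeneous (d : Fin n → ℕ) {k : ℕ} {p : MvPolynomial (Fin n) F}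
    (hp : p.IsHomogeneous k) : (lowering d p).IsHomogeneous (k - 1) := by
  rw [lowering_apply]
  refine IsHomogeneous.sum _ _ _ fun i _ => IsHomogeneous.sub ?_ ?_
  · rw [smul_eq_C_mul]
    exact hp.pderiv.C_mul _
  · rcases Nat.lt_or_ge k 2 with hk | hk
    · have : (pderiv i p).totalDegree = 0 := by
        have := (hp.pderiv (i := i)).totalDegree_le
        omega
      rw [totalDegree_eq_zero_iff_eq_C.mp this, pderiv_C, mul_zero]
      exact isHomogeneous_zero _ _ _
    · have := (isHomogeneous_X F i).mul ((hp.pderiv (i := i)).pderiv (i := i))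
      have h2 : 1 + (k - 1 - 1) = k - 1 := by omega
      rwa [h2] at this

theorem X_pow_mem_powerIdeal (d : Fin n → ℕ) (i : Fin n) :
    (X i : MvPolynomial (Fin n) F) ^ (d i + 1) ∈ powerIdeal F d :=
  Ideal.subset_span ⟨i, rfl⟩

/-- In one variable the operator sends x^a to a(d + 1 - a) x^(a-1), which vanishes at a = d + 1.
Hence the sl₂-action descends to the quotient by the powers. -/
theorem lowering_mem_powerIdeal (d : Fin n → ℕ) {p : MvPolynomial (Fin n) F}
    (hp : p ∈ powerIdeal F d) : lowering d p ∈ powerIdeal F d := by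
  have key (i : Fin n) (q : MvPolynomial (Fin n) F) :
      lowering d (q * X i ^ (d i + 1)) ∈ powerIdeal F d := by
    rw [lowering_apply]
    refine Ideal.sum_mem _ fun j _ => ?_
    rcases eq_or_ne i j with rfl | hij
    · have h : (d i : F) • pderiv i (q * X i ^ (d i + 1)) -
          X i * pderiv i (pderiv i (q * X i ^ (d i + 1))) =
          ((d i : F) • pderiv i q - X i * pderiv i (pderiv i q) -
            2 * (d i + 1 : MvPolynomial (Fin n) F) * pderiv i q) * X i ^ (d i + 1) := by
        simp only [pderiv_mul, pderiv_pow, pderiv_X_self, map_add, smul_eq_C_mul, map_natCast,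
          Nat.add_sub_cancel, Derivation.map_natCast, pderiv_one]
        -- The second derivative produces the exponent d_i - 1, truncated when d_i = 0.
        rcases Nat.eq_zero_or_pos (d i) with h0 | h0
        · simp only [h0]
          simp
          ring
        · obtain ⟨k, hk⟩ := Nat.exists_eq_succ_of_ne_zero h0.ne'
          simp only [hk, Nat.succ_eq_add_one, Nat.add_sub_cancel]
          push_cast
          ring
      rw [h]
      exact Ideal.mul_mem_left _ _ (X_pow_mem_powerIdeal d i)
    · have h (r : MvPolynomial (Fin n) F) :
          pderiv j (r * X i ^ (d i + 1)) = pderiv j r * X i ^ (d i + 1) := by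
        rw [pderiv_mul, pderiv_pow, pderiv_X_of_ne hij, mul_zero, mul_zero, add_zero]
      rw [h, h, smul_eq_C_mul, ← mul_assoc, ← mul_assoc, ← sub_mul]
      exact Ideal.mul_mem_left _ _ (X_pow_mem_powerIdeal d i)
  induction hp using Submodule.span_induction with
  | mem x hx =>
    obtain ⟨i, rfl⟩ := hx
    simpa using key i 1
  | zero => simp
  | add x y _ _ hx hy => rw [map_add]; exact add_mem hx hy
  | smul a x hx' hx =>
    -- The operator is not linear over polynomials, so the hypothesis on x says nothing about a • x;
    -- a second induction carries an arbitrary multiplier.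
    clear hx
    induction hx' using Submodule.span_induction generalizing a with
    | mem x hx =>
      obtain ⟨i, rfl⟩ := hx
      exact key i a
    | zero => simp
    | add x y _ _ hx hy => rw [smul_add, map_add]; exact add_mem (hx a) (hy a)
    | smul b x _ hx => rw [smul_smul]; exact hx _

theorem mem_powerIdeal_of_isHomogeneous (d : Fin n → ℕ) {k : ℕ} {p : MvPolynomial (Fin n) F}
    (hp : p.IsHomogeneous k) (hk : ∑ i, d i < k) : p ∈ powerIdeal F d := by
  rw [p.as_sum]
  refine Ideal.sum_mem _ fun a ha => ?_
  have hdeg : ∑ i, a i = k := by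
    rw [← Finsupp.degree_eq_sum]
    by_contra h
    exact mem_support_iff.mp ha (hp.coeff_eq_zero h)
  obtain ⟨i, -, hi⟩ := Finset.exists_lt_of_sum_lt (hdeg ▸ hk)
  have : monomial a (coeff a p) =
      monomial (a - Finsupp.single i (d i + 1)) (coeff a p) * X i ^ (d i + 1) := by
    rw [X_pow_eq_monomial, monomial_mul, mul_one, tsub_add_cancel_of_le]
    exact Finsupp.single_le_iff.mpr hi
  rw [this]
  exact Ideal.mul_mem_left _ _ (X_pow_mem_powerIdeal d i)

theorem iterate_lowering_isHomogeneous (d : Fin n → ℕ) {k : ℕ} {p : MvPolynomial (Fin n) F}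
    (hp : p.IsHomogeneous k) (t : ℕ) : ((lowering d)^[t] p).IsHomogeneous (k - t) := by
  induction t with
  | zero => exact hp
  | succ t ih =>
    rw [Function.iterate_succ_apply', ← Nat.sub_sub]
    exact lowering_isHomogeneous d ih

/-- The classical computation along the string below a vector u killed by ℓ, of weight N = 2k - D:
each step adds one commutator, and these sum to (t + 1)(N - t). -/
theorem varSum_mul_iterate_lowering (d : Fin n → ℕ) {k N : ℕ} {u : MvPolynomial (Fin n) F}
    (hu : u.IsHomogeneous k) (hN : N + ∑ i, d i = 2 * k) (hk : k ≤ ∑ i, d i)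
    (h0 : varSum F n * u ∈ powerIdeal F d) (t : ℕ) (ht : t < N) :
    varSum F n * (lowering d)^[t + 1] u - ((t + 1 : F) * (N - t)) • (lowering d)^[t] u ∈
      powerIdeal F d := by
  have hcast : (N : F) + ((∑ i, d i : ℕ) : F) = 2 * k := by
    rw [← Nat.cast_add, hN, Nat.cast_mul, Nat.cast_ofNat]
  induction t with
  | zero =>
    have h := lowering_mem_powerIdeal d h0
    rw [lowering_varSum_mul d hu] at h
    convert h using 1
    rw [sub_eq_add_neg, ← neg_smul]
    congr 2
    simp only [Nat.cast_zero]
    linear_combination -hcast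
  | succ t ih =>
    have h := lowering_mem_powerIdeal d (ih (by omega))
    rw [map_sub, map_smul, lowering_varSum_mul d (iterate_lowering_isHomogeneous d hu (t + 1)),
      ← Function.iterate_succ_apply' (lowering d), ← Function.iterate_succ_apply' (lowering d),
      add_sub_assoc, ← sub_smul] at h
    convert h using 1
    rw [sub_eq_add_neg, ← neg_smul]
    congr 2
    rw [Nat.cast_sub (by omega)]
    simp only [Nat.cast_add, Nat.cast_one]
    linear_combination -hcast

theorem exists_varSum_pow_mul_iterate_lowering [CharZero F] (d : Fin n → ℕ) {k N : ℕ}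
    {u : MvPolynomial (Fin n) F} (hu : u.IsHomogeneous k) (hN : N + ∑ i, d i = 2 * k)
    (hk : k ≤ ∑ i, d i) (h0 : varSum F n * u ∈ powerIdeal F d) (s t : ℕ) (ht : s + t ≤ N) :
    ∃ c : F, c ≠ 0 ∧
      varSum F n ^ s * (lowering d)^[s + t] u - c • (lowering d)^[t] u ∈ powerIdeal F d := by
  induction s with
  | zero => exact ⟨1, one_ne_zero, by simp⟩
  | succ s ih =>
    obtain ⟨c, hc, h⟩ := ih (by omega)
    have h1 := varSum_mul_iterate_lowering d hu hN hk h0 (s + t) (by omega)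
    refine ⟨((s + t : ℕ) + 1 : F) * (N - (s + t : ℕ)) * c, ?_, ?_⟩
    · refine mul_ne_zero (mul_ne_zero (Nat.cast_add_one_ne_zero _) ?_) hc
      rw [sub_ne_zero]
      exact_mod_cast (by omega : N ≠ s + t)
    · have h2 := add_mem (Ideal.mul_mem_left _ (varSum F n ^ s) h1)
        (Ideal.mul_mem_left _ (C (((s + t : ℕ) + 1 : F) * (N - (s + t : ℕ)))) h)
      convert h2 using 1
      rw [show s + 1 + t = s + t + 1 by ring]
      simp only [smul_eq_C_mul, map_mul]
      ring

/-- Surjectivity in the strong Lefschetz property of the monomial complete intersection. -/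
theorem exists_sub_varSum_pow_mul_mem [CharZero F] (d : Fin n → ℕ) {m l : ℕ}
    (hl : 2 * m + l = ∑ i, d i) {v : MvPolynomial (Fin n) F} (hv : v.IsHomogeneous (m + l)) :
    ∃ w : MvPolynomial (Fin n) F, w.IsHomogeneous m ∧
      v - varSum F n ^ l * w ∈ powerIdeal F d := by
  suffices H : ∀ (r : ℕ) (v : MvPolynomial (Fin n) F), v.IsHomogeneous (m + l) →
      varSum F n ^ r * v ∈ powerIdeal F d → ∃ w : MvPolynomial (Fin n) F, w.IsHomogeneous m ∧
      v - varSum F n ^ l * w ∈ powerIdeal F d by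
    -- Induction on the power of ℓ that kills v; ℓ^(m+1) v has degree D + 1, hence lies in the
    -- ideal.
    refine H (m + 1) v hv (mem_powerIdeal_of_isHomogeneous d
      ((isHomogeneous_varSum.pow (m + 1)).mul hv) ?_)
    omega
  intro r
  induction r with
  | zero =>
    intro v hv h
    exact ⟨0, isHomogeneous_zero _ _ _, by simpa using h⟩
  | succ r ih =>
    intro v hv h
    have hu : (varSum F n ^ r * v).IsHomogeneous (m + l + r) := by
      have := (isHomogeneous_varSum.pow r).mul hv
      rwa [show 1 * r + (m + l) = m + l + r by ring] at this
    rcases Nat.lt_or_ge m r with hr | hr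
    · exact ih v hv (mem_powerIdeal_of_isHomogeneous d hu (by omega))
    have h0 : varSum F n * (varSum F n ^ r * v) ∈ powerIdeal F d := by
      rwa [← mul_assoc, ← pow_succ']
    have hN : (l + 2 * r) + ∑ i, d i = 2 * (m + l + r) := by omega
    -- The vector u = ℓ^r v is killed by ℓ. Going down r steps and back up recovers c u, so
    -- subtracting c⁻¹ times the r-th lowering of u from v leaves something killed by ℓ^r. The
    -- second relation shows that the subtracted term is itself a multiple of ℓ^l.
    obtain ⟨c, hc, h1⟩ :=
      exists_varSum_pow_mul_iterate_lowering d hu hN (by omega) h0 r 0 (by omega)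
    obtain ⟨c', hc', h2⟩ :=
      exists_varSum_pow_mul_iterate_lowering d hu hN (by omega) h0 (l + r) r (by omega)
    have hE := iterate_lowering_isHomogeneous d hu r
    have hE' := iterate_lowering_isHomogeneous d hu (l + r + r)
    rw [show m + l + r - r = m + l by omega] at hE
    rw [show m + l + r - (l + r + r) = m - r by omega] at hE'
    set u := varSum F n ^ r * v with hu'
    simp only [add_zero, Function.iterate_zero, id] at h1
    obtain ⟨w, hw, h3⟩ := ih (v - C c⁻¹ * (lowering d)^[r] u) (hv.sub (hE.C_mul _)) (by
      have := Ideal.mul_mem_left _ (-C c⁻¹) h1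
      convert this using 1
      rw [smul_eq_C_mul]
      have hcc : C c⁻¹ * C c = (1 : MvPolynomial (Fin n) F) := by
        rw [← map_mul, inv_mul_cancel₀ hc, map_one]
      linear_combination (1 - C c⁻¹ * C c) * hu' - (varSum F n ^ r * v) * hcc)
    refine ⟨w + C c⁻¹ * (C c'⁻¹ * (varSum F n ^ r * (lowering d)^[l + r + r] u)),
      hw.add ((IsHomogeneous.C_mul ?_ _).C_mul _), ?_⟩
    · have := (isHomogeneous_varSum.pow r).mul hE'
      rwa [show 1 * r + (m - r) = m by omega] at this
    · have := add_mem h3 (Ideal.mul_mem_left _ (-C c⁻¹ * C c'⁻¹) h2)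
      convert this using 1
      have hcc : C c'⁻¹ * C c' = (1 : MvPolynomial (Fin n) F) := by
        rw [← map_mul, inv_mul_cancel₀ hc', map_one]
      rw [smul_eq_C_mul]
      linear_combination (-C c⁻¹ * (lowering d)^[r] u) * hcc

end Lefschetz

/-! ### Ballot monomials span the quotient -/

section Spanning

variable {F : Type*} [Field F] {n : ℕ}

/-- The exponent vectors bounded by `d` that satisfy the lattice word condition
`e_i + 2 (e_1 + ⋯ + e_{i-1}) ≤ d_1 + ⋯ + d_{i-1}`. -/
def IsBallot (d : Fin n → ℕ) (e : Fin n →₀ ℕ) : Prop :=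
  ∀ i, e i ≤ d i ∧ e i + 2 * ∑ j ∈ Finset.Iio i, e j ≤ ∑ j ∈ Finset.Iio i, d j

/-- The span of the products of powers of the sum of the variables with ballot monomials, in degree
`k` and modulo the powers of the variables. -/
noncomputable def ballotSpan (F : Type*) [Field F] {n : ℕ} (d : Fin n → ℕ) (k : ℕ) :
    Submodule F (MvPolynomial (Fin n) F) :=
  Submodule.span F {q | ∃ (e : Fin n →₀ ℕ) (j : ℕ), IsBallot d e ∧ j + e.degree = k ∧
    q = varSum F n ^ j * monomial e 1} ⊔ (powerIdeal F d).restrictScalars F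

/-- The variant of `ballotSpan` in which the powers are bounded by the length of the Lefschetz
string that starts at the ballot monomial. -/
noncomputable def stringSpan (F : Type*) [Field F] {n : ℕ} (d : Fin n → ℕ) (k : ℕ) :
    Submodule F (MvPolynomial (Fin n) F) :=
  Submodule.span F {q | ∃ (e : Fin n →₀ ℕ) (j : ℕ), IsBallot d e ∧ j + e.degree = k ∧
    j + 2 * e.degree ≤ ∑ i, d i ∧ q = varSum F n ^ j * monomial e 1} ⊔
    (powerIdeal F d).restrictScalars F

theorem mem_ballotSpan_of_mem_powerIdeal {d : Fin n → ℕ} {p : MvPolynomial (Fin n) F}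
    (hp : p ∈ powerIdeal F d) (k : ℕ) : p ∈ ballotSpan F d k :=
  Submodule.mem_sup_right hp

theorem varSum_mul_mem_ballotSpan {d : Fin n → ℕ} {k : ℕ} {p : MvPolynomial (Fin n) F}
    (hp : p ∈ ballotSpan F d k) : varSum F n * p ∈ ballotSpan F d (k + 1) := by
  suffices h : ballotSpan F d k ≤
      (ballotSpan F d (k + 1)).comap (LinearMap.mulLeft F (varSum F n)) from h hp
  refine sup_le (Submodule.span_le.mpr ?_) fun q hq => ?_
  · rintro _ ⟨e, j, he, hj, rfl⟩
    refine Submodule.mem_sup_left (Submodule.subset_span ⟨e, j + 1, he, by omega, ?_⟩)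
    simp [pow_succ', mul_assoc]
  · exact mem_ballotSpan_of_mem_powerIdeal (Ideal.mul_mem_left _ _ hq) _

/-- Up to the middle degree the bound on j is automatic. Above it, Lefschetz surjectivity writes p
as ℓ^l w with w in the mirror degree m = D - k, and expanding w yields terms within the bound. -/
theorem mem_stringSpan_of_forall_mem_ballotSpan [CharZero F] (d : Fin n → ℕ)
    (H : ∀ (k : ℕ) (p : MvPolynomial (Fin n) F), p.IsHomogeneous k → p ∈ ballotSpan F d k)
    {k : ℕ} {p : MvPolynomial (Fin n) F} (hp : p.IsHomogeneous k) : p ∈ stringSpan F d k := by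
  rcases Nat.lt_or_ge (∑ i, d i) k with hk | hk
  · exact Submodule.mem_sup_right (mem_powerIdeal_of_isHomogeneous d hp hk)
  rcases Nat.lt_or_ge (∑ i, d i) (2 * k) with hk2 | hk2
  · obtain ⟨m, hm⟩ := Nat.exists_eq_add_of_le hk
    obtain ⟨l, rfl⟩ : ∃ l, k = m + l := Nat.exists_eq_add_of_le (by omega)
    obtain ⟨w, hw, h⟩ := exists_sub_varSum_pow_mul_mem d (m := m) (l := l) (by omega) hp
    have h2 : ballotSpan F d m ≤
        (stringSpan F d (m + l)).comap (LinearMap.mulLeft F (varSum F n ^ l)) := by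
      refine sup_le (Submodule.span_le.mpr ?_) fun q hq => ?_
      · rintro _ ⟨e, j, he, hj, rfl⟩
        refine Submodule.mem_sup_left
          (Submodule.subset_span ⟨e, l + j, he, by omega, by omega, ?_⟩)
        simp [pow_add, mul_assoc]
      · exact Submodule.mem_sup_right (Ideal.mul_mem_left _ _ hq)
    have h3 : varSum F n ^ l * w ∈ stringSpan F d (m + l) := h2 (H m w hw)
    have h4 : p - varSum F n ^ l * w ∈ stringSpan F d (m + l) := Submodule.mem_sup_right h
    simpa using add_mem h4 h3
  · have h2 : ballotSpan F d k ≤ stringSpan F d k := by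
      refine sup_le_sup_right (Submodule.span_mono ?_) _
      rintro _ ⟨e, j, he, hj, rfl⟩
      exact ⟨e, j, he, hj, by omega, rfl⟩
    exact h2 (H k p hp)

theorem varSum_succ : varSum F (n + 1) = rename Fin.castSucc (varSum F n) + X (Fin.last n) := by
  simp [varSum, Fin.sum_univ_castSucc, map_sum]

theorem rename_mem_powerIdeal {d : Fin (n + 1) → ℕ} {p : MvPolynomial (Fin n) F}
    (hp : p ∈ powerIdeal F (d ∘ Fin.castSucc)) : rename Fin.castSucc p ∈ powerIdeal F d := by
  suffices h : powerIdeal F (d ∘ Fin.castSucc) ≤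
      (powerIdeal F d).comap (rename Fin.castSucc : MvPolynomial (Fin n) F →ₐ[F] _) from h hp
  refine Ideal.span_le.mpr ?_
  rintro _ ⟨i, rfl⟩
  simpa using X_pow_mem_powerIdeal d i.castSucc

theorem sum_Iio_castSucc (f : Fin (n + 1) → ℕ) (i : Fin n) :
    ∑ j ∈ Finset.Iio i.castSucc, f j = ∑ j ∈ Finset.Iio i, f j.castSucc := by
  rw [← Fin.map_castSuccEmb_Iio, Finset.sum_map]
  rfl

theorem sum_Iio_last (f : Fin (n + 1) → ℕ) :
    ∑ j ∈ Finset.Iio (Fin.last n), f j = ∑ j, f (Fin.castSucc j) := by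
  rw [Fin.Iio_last_eq_map, Finset.sum_map]
  rfl

/-- At the last index the ballot condition involves only b and the total degree of e, so the string
bound supplies it. -/
theorem IsBallot.snoc {d : Fin (n + 1) → ℕ} {e : Fin n →₀ ℕ} {b : ℕ}
    (he : IsBallot (d ∘ Fin.castSucc) e) (hb : b ≤ d (Fin.last n))
    (hb' : b + 2 * e.degree ≤ ∑ i, d (Fin.castSucc i)) :
    IsBallot d (e.mapDomain Fin.castSucc + Finsupp.single (Fin.last n) b) := by
  have h1 (j : Fin n) :
      (e.mapDomain Fin.castSucc + Finsupp.single (Fin.last n) b) j.castSucc = e j := by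
    rw [Finsupp.add_apply, Finsupp.mapDomain_apply (Fin.castSucc_injective n),
      Finsupp.single_eq_of_ne (Fin.castSucc_lt_last j).ne, add_zero]
  have h2 : (e.mapDomain Fin.castSucc + Finsupp.single (Fin.last n) b) (Fin.last n) = b := by
    rw [Finsupp.add_apply, Finsupp.single_eq_same, Finsupp.mapDomain_of_notMem_range, zero_add]
    rintro ⟨j, hj⟩
    exact (Fin.castSucc_lt_last j).ne hj
  intro i
  induction i using Fin.lastCases with
  | last =>
    rw [h2, sum_Iio_last, sum_Iio_last]
    simp only [h1]
    rw [← Finsupp.degree_eq_sum]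
    exact ⟨hb, hb'⟩
  | cast i =>
    rw [h1, sum_Iio_castSucc, sum_Iio_castSucc]
    simp only [h1]
    exact he i

theorem monomial_snoc (e : Fin n →₀ ℕ) (b : ℕ) :
    (monomial (e.mapDomain Fin.castSucc + Finsupp.single (Fin.last n) b) 1 :
      MvPolynomial (Fin (n + 1)) F) =
    rename Fin.castSucc (monomial e 1) * X (Fin.last n) ^ b := by
  rw [rename_monomial, X_pow_eq_monomial, monomial_mul, mul_one]

theorem exists_eq_snoc (a : Fin (n + 1) →₀ ℕ) :
    ∃ (e : Fin n →₀ ℕ) (b : ℕ),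
      a = e.mapDomain Fin.castSucc + Finsupp.single (Fin.last n) b := by
  refine ⟨a.comapDomain Fin.castSucc (Fin.castSucc_injective n).injOn, a (Fin.last n), ?_⟩
  ext i
  induction i using Fin.lastCases with
  | last =>
    rw [Finsupp.add_apply, Finsupp.single_eq_same, Finsupp.mapDomain_of_notMem_range, zero_add]
    rintro ⟨j, hj⟩
    exact (Fin.castSucc_lt_last j).ne hj
  | cast i =>
    rw [Finsupp.add_apply, Finsupp.mapDomain_apply (Fin.castSucc_injective n),
      Finsupp.single_eq_of_ne (Fin.castSucc_lt_last i).ne, add_zero, Finsupp.comapDomain_apply]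

/-- Induction on the degree: multiples of ℓ are already handled, so the old sum of variables and -y,
with y the new variable, are interchangeable. -/
theorem mem_ballotSpan_succ (d : Fin (n + 1) → ℕ)
    (H : ∀ (k : ℕ) (p : MvPolynomial (Fin n) F), p.IsHomogeneous k →
      p ∈ stringSpan F (d ∘ Fin.castSucc) k)
    (k : ℕ) : ∀ p : MvPolynomial (Fin (n + 1)) F, p.IsHomogeneous k → p ∈ ballotSpan F d k := by
  induction k with
  | zero =>
    intro p hp
    have hp0 : p.totalDegree = 0 := Nat.le_zero.mp hp.totalDegree_le
    rw [totalDegree_eq_zero_iff_eq_C.mp hp0, ← mul_one (C _), ← smul_eq_C_mul]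
    refine Submodule.smul_mem _ _ (Submodule.mem_sup_left (Submodule.subset_span
      ⟨0, 0, fun i => ?_, ?_, ?_⟩)) <;> simp
  | succ k ih =>
    set y : MvPolynomial (Fin (n + 1)) F := X (Fin.last n) with hy
    have hl : ∀ p : MvPolynomial (Fin (n + 1)) F, p.IsHomogeneous k →
        varSum F (n + 1) * p ∈ ballotSpan F d (k + 1) :=
      fun p hp => varSum_mul_mem_ballotSpan (ih p hp)
    -- Trading every old ℓ for -y preserves i + j; at i = 0 either y^j lies in the power ideal or
    -- the string bound makes the extended exponent ballot.
    have hstring : ∀ (e : Fin n →₀ ℕ), IsBallot (d ∘ Fin.castSucc) e → ∀ i j : ℕ,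
        i + j + e.degree = k + 1 → i + j + 2 * e.degree ≤ ∑ i, d (Fin.castSucc i) →
        rename Fin.castSucc (varSum F n) ^ i * (rename Fin.castSucc (monomial e 1) * y ^ j) ∈
          ballotSpan F d (k + 1) := by
      intro e he i
      induction i with
      | zero =>
        intro j hj hj'
        rw [pow_zero, one_mul]
        rcases Nat.lt_or_ge (d (Fin.last n)) j with h | h
        · refine mem_ballotSpan_of_mem_powerIdeal (Ideal.mul_mem_left _ _ ?_) _
          exact Ideal.pow_mem_of_pow_mem _ (X_pow_mem_powerIdeal d (Fin.last n)) h
        · refine Submodule.mem_sup_left (Submodule.subset_span ⟨_, 0, he.snoc h (by omega), ?_, ?_⟩)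
          · rw [map_add, Finsupp.degree_mapDomain, Finsupp.degree_single]
            omega
          · rw [monomial_snoc, pow_zero, one_mul]
      | succ i ihi =>
        intro j hj hj'
        have h1 := hl (rename Fin.castSucc (varSum F n) ^ i *
          (rename Fin.castSucc (monomial e 1) * y ^ j)) (by
            have := ((isHomogeneous_varSum (F := F) (n := n)).rename_isHomogeneous
              (f := Fin.castSucc)).pow i |>.mul
                (((isHomogeneous_monomial (1 : F) (d := e) rfl).rename_isHomogeneous
                  (f := Fin.castSucc)).mul (isHomogeneous_X_pow (R := F) (Fin.last n) j))
            rwa [show 1 * i + (e.degree + j) = k by omega] at this)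
        have h2 := ihi (j + 1) (by omega) (by omega)
        convert sub_mem h1 h2 using 1
        rw [varSum_succ]
        ring
    -- The opposite trade removes y, so that the hypothesis in n variables applies.
    have hsplit : ∀ (b s : ℕ) (q : MvPolynomial (Fin n) F), q.IsHomogeneous s → s + b = k + 1 →
        rename Fin.castSucc q * y ^ b ∈ ballotSpan F d (k + 1) := by
      intro b
      induction b with
      | zero =>
        rintro s q hq rfl
        have h : stringSpan F (d ∘ Fin.castSucc) (k + 1) ≤ (ballotSpan F d (k + 1)).comap
            (rename Fin.castSucc : MvPolynomial (Fin n) F →ₐ[F] _).toLinearMap := by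
          refine sup_le (Submodule.span_le.mpr ?_) fun q hq => ?_
          · rintro _ ⟨e, j, he, hj, hj', rfl⟩
            have := hstring e he j 0 (by omega) (by simpa using hj')
            simpa using this
          · exact mem_ballotSpan_of_mem_powerIdeal (rename_mem_powerIdeal hq) _
        simpa using h (H _ q hq)
      | succ b ihb =>
        intro s q hq hs
        have h1 := hl (rename Fin.castSucc q * y ^ b) (by
          have := (hq.rename_isHomogeneous (f := Fin.castSucc)).mul
            (isHomogeneous_X_pow (R := F) (Fin.last n) b)
          rwa [show s + b = k by omega] at this)
        have h2 := ihb (1 + s) (varSum F n * q) (isHomogeneous_varSum.mul hq) (by omega)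
        convert sub_mem h1 h2 using 1
        rw [varSum_succ, map_mul]
        ring
    intro p hp
    rw [p.as_sum]
    refine Submodule.sum_mem _ fun a ha => ?_
    obtain ⟨e, b, hab⟩ := exists_eq_snoc a
    have hdeg : a.degree = k + 1 := by
      by_contra h
      exact mem_support_iff.mp ha (hp.coeff_eq_zero h)
    rw [← mul_one (coeff a p), ← smul_eq_mul, ← smul_monomial]
    refine Submodule.smul_mem _ _ ?_
    rw [hab, monomial_snoc]
    refine hsplit b e.degree _ (isHomogeneous_monomial _ rfl) ?_
    rw [← hdeg, hab, map_add, Finsupp.degree_mapDomain, Finsupp.degree_single]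

theorem mem_ballotSpan_of_isHomogeneous [CharZero F] (d : Fin n → ℕ) (k : ℕ)
    (p : MvPolynomial (Fin n) F) (hp : p.IsHomogeneous k) : p ∈ ballotSpan F d k := by
  induction n generalizing k with
  | zero =>
    obtain ⟨c, rfl⟩ := C_surjective (Fin 0) p
    rcases eq_or_ne c 0 with rfl | hc
    · simp
    have hk : k = 0 := hp.inj_right (isHomogeneous_C _ c) (by simpa using hc)
    subst hk
    rw [← mul_one (C _), ← smul_eq_C_mul]
    exact Submodule.smul_mem _ _ (Submodule.mem_sup_left (Submodule.subset_span
      ⟨0, 0, fun i => i.elim0, by simp, by simp⟩))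
  | succ n ih =>
    exact mem_ballotSpan_succ d (fun k p hp =>
      mem_stringSpan_of_forall_mem_ballotSpan _ (fun k p hp => ih _ k p hp) hp) k p hp

theorem span_ballot_sup_oneRowIdeal [CharZero F] (d : Fin n → ℕ) :
    Submodule.span F ((fun e : Fin n →₀ ℕ => monomial e (1 : F)) '' {e | IsBallot d e}) ⊔
      (oneRowIdeal F d).restrictScalars F = ⊤ := by
  rw [eq_top_iff]
  rintro p -
  have hJ : powerIdeal F d ≤ oneRowIdeal F d := Ideal.span_mono Set.subset_union_left
  have hl : varSum F n ∈ oneRowIdeal F d := Ideal.subset_span (Or.inr rfl)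
  have h (k : ℕ) : ballotSpan F d k ≤
      Submodule.span F ((fun e : Fin n →₀ ℕ => monomial e (1 : F)) '' {e | IsBallot d e}) ⊔
      (oneRowIdeal F d).restrictScalars F := by
    refine sup_le (Submodule.span_le.mpr ?_) fun q hq => Submodule.mem_sup_right (hJ hq)
    rintro _ ⟨e, j, he, hj, rfl⟩
    rcases j with - | j
    · exact Submodule.mem_sup_left (Submodule.subset_span ⟨e, he, by simp⟩)
    · refine Submodule.mem_sup_right (Ideal.mul_mem_right _ _ ?_)
      exact Ideal.pow_mem_of_mem _ hl _ (Nat.succ_pos j)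
  rw [← sum_homogeneousComponent p]
  exact Submodule.sum_mem _ fun k _ => h k
    (mem_ballotSpan_of_isHomogeneous d k _ (homogeneousComponent_isHomogeneous k p))

end Spanning

/-! ### Standard monomials of an arbitrary ideal -/

section StandardMonomials

variable {σ F : Type*} [Field F] (m : MonomialOrder σ) (I : Ideal (MvPolynomial σ F))

/-- A monomial is standard as soon as it is not itself a leading monomial of an element of `I`. -/
theorem mem_standardMonomials_of_forall {e : σ →₀ ℕ}
    (h : ∀ f ∈ I, f ≠ 0 → m.degree f ≠ e) : e ∈ standardMonomials m I := by
  classical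
  intro hmem
  have hset : {g : MvPolynomial σ F | ∃ f ∈ I, f ≠ 0 ∧ g = monomial (m.degree f) 1} =
      (fun s => monomial s (1 : F)) '' {s | ∃ f ∈ I, f ≠ 0 ∧ m.degree f = s} := by
    ext g
    constructor
    · rintro ⟨f, hf, hf0, rfl⟩
      exact ⟨_, ⟨f, hf, hf0, rfl⟩, rfl⟩
    · rintro ⟨_, ⟨f, hf, hf0, rfl⟩, rfl⟩
      exact ⟨f, hf, hf0, rfl⟩
  rw [initialIdeal, hset, mem_ideal_span_monomial_image] at hmem
  -- The initial ideal is monomial, so x^e is divisible by a leading monomial; multiplying f by the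
  -- quotient gives leading monomial x^e.
  obtain ⟨_, ⟨f, hf, hf0, rfl⟩, hle⟩ := hmem e (by simp [mem_support_iff])
  have hmon : (monomial (e - m.degree f) 1 : MvPolynomial σ F) ≠ 0 := by simp
  refine h (monomial (e - m.degree f) 1 * f) (I.mul_mem_left _ hf) (mul_ne_zero hmon hf0) ?_
  rw [m.degree_mul hmon hf0, m.degree_monomial, if_neg one_ne_zero, tsub_add_cancel_of_le hle]

/-- Standard monomials are linearly independent modulo `I`. -/
theorem eq_zero_of_mem_of_support_subset {f : MvPolynomial σ F} (hf : f ∈ I)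
    (h : ∀ a ∈ f.support, a ∈ standardMonomials m I) : f = 0 := by
  by_contra h0
  exact h _ (m.degree_mem_support h0) (Ideal.subset_span ⟨f, hf, h0, rfl⟩)

theorem coeff_eq_zero_of_mem_span_monomial {S : Set (σ →₀ ℕ)} {s : MvPolynomial σ F}
    (hs : s ∈ Submodule.span F ((fun e : σ →₀ ℕ => monomial e (1 : F)) '' S))
    {a : σ →₀ ℕ} (ha : a ∉ S) : coeff a s = 0 := by
  classical
  have : Submodule.span F ((fun e : σ →₀ ℕ => monomial e (1 : F)) '' S) ≤
      LinearMap.ker (lcoeff F a) := by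
    refine Submodule.span_le.mpr ?_
    rintro _ ⟨e, he, rfl⟩
    simp only [SetLike.mem_coe, LinearMap.mem_ker, lcoeff_apply, coeff_monomial]
    rw [if_neg]
    rintro rfl
    exact ha he
  exact this hs

variable {m I}

/-- A set of standard monomials that spans the quotient consists of all standard monomials. -/
theorem standardMonomials_eq_of_span {S : Set (σ →₀ ℕ)} (hS : S ⊆ standardMonomials m I)
    (hspan : Submodule.span F ((fun e : σ →₀ ℕ => monomial e (1 : F)) '' S) ⊔
      I.restrictScalars F = ⊤) : standardMonomials m I = S := by
  classical
  refine Set.Subset.antisymm (fun a ha => ?_) hS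
  by_contra haS
  obtain ⟨s, hs, u, hu, hsu⟩ := Submodule.mem_sup.mp
    (hspan ▸ Submodule.mem_top : (monomial a (1 : F)) ∈ _)
  -- Here u = x^a - s involves only standard monomials and lies in I.
  have hu0 : u = 0 := by
    refine eq_zero_of_mem_of_support_subset m I hu fun b hb => ?_
    by_contra hbS
    have h := congrArg (coeff b) hsu
    rw [coeff_add, coeff_eq_zero_of_mem_span_monomial hs fun h => hbS (hS h), zero_add,
      coeff_monomial, if_neg (by rintro rfl; exact hbS ha)] at h
    exact mem_support_iff.mp hb h
  have h := congrArg (coeff a) hsu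
  rw [hu0, add_zero, coeff_eq_zero_of_mem_span_monomial hs haS, coeff_monomial, if_pos rfl] at h
  exact zero_ne_one h

theorem linearIndependent_of_subset_standardMonomials {S : Set (σ →₀ ℕ)}
    (hS : S ⊆ standardMonomials m I) :
    LinearIndependent F (fun e : S => Ideal.Quotient.mk I (monomial e.1 (1 : F))) := by
  classical
  rw [linearIndependent_iff']
  intro t g hg i hi
  have hcoeff (a : σ →₀ ℕ) : coeff a (∑ j ∈ t, g j • monomial j.1 (1 : F)) =
      ∑ j ∈ t, if j.1 = a then g j else 0 := by
    simp [coeff_sum, coeff_monomial]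
  have h0 : ∑ j ∈ t, g j • monomial j.1 (1 : F) = 0 := by
    refine eq_zero_of_mem_of_support_subset m I ?_ fun a ha => ?_
    · rw [← Ideal.Quotient.eq_zero_iff_mem, map_sum]
      exact hg
    · rw [mem_support_iff, hcoeff] at ha
      obtain ⟨j, -, hj⟩ := Finset.exists_ne_zero_of_sum_ne_zero ha
      by_contra h
      refine hj (if_neg ?_)
      rintro rfl
      exact h (hS j.2)
  have h := hcoeff i.1
  rw [h0, coeff_zero] at h
  simpa [Subtype.coe_inj, hi] using h.symm

theorem span_range_mk_eq_top {S : Set (σ →₀ ℕ)}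
    (hspan : Submodule.span F ((fun e : σ →₀ ℕ => monomial e (1 : F)) '' S) ⊔
      I.restrictScalars F = ⊤) :
    Submodule.span F (Set.range fun e : S => Ideal.Quotient.mk I (monomial e.1 (1 : F))) = ⊤ := by
  rw [eq_top_iff]
  rintro q -
  obtain ⟨p, rfl⟩ := Ideal.Quotient.mk_surjective q
  obtain ⟨s, hs, u, hu, rfl⟩ := Submodule.mem_sup.mp (hspan ▸ Submodule.mem_top : p ∈ _)
  rw [map_add, Ideal.Quotient.eq_zero_iff_mem.mpr hu, add_zero]
  have h : Submodule.span F ((fun e : σ →₀ ℕ => monomial e (1 : F)) '' S) ≤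
      (Submodule.span F (Set.range fun e : S =>
        Ideal.Quotient.mk I (monomial e.1 (1 : F)))).comap
          (Ideal.Quotient.mkₐ F I).toLinearMap := by
    refine Submodule.span_le.mpr ?_
    rintro _ ⟨e, he, rfl⟩
    exact Submodule.subset_span ⟨⟨e, he⟩, rfl⟩
  exact h hs

end StandardMonomials

/-! ### Apolarity and trailing monomials -/

section InverseSystem

variable {F : Type*} [Field F] {n : ℕ}

/-- The functional on polynomials given by letting them act on `f` as differential operators and
evaluating at the origin. -/
noncomputable def pairing (f : MvPolynomial (Fin n) F) : MvPolynomial (Fin n) F →ₗ[F] F :=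
  (basisMonomials (Fin n) F).constr F fun a => (∏ i, (a i).factorial : ℕ) * coeff a f

theorem pairing_monomial (f : MvPolynomial (Fin n) F) (a : Fin n →₀ ℕ) :
    pairing f (monomial a 1) = (∏ i, (a i).factorial : ℕ) * coeff a f := by
  have := (basisMonomials (Fin n) F).constr_basis F
    (fun a => ((∏ i, (a i).factorial : ℕ) : F) * coeff a f) a
  simpa [pairing] using this

theorem pairing_apply (f g : MvPolynomial (Fin n) F) :
    pairing f g = ∑ a ∈ g.support, coeff a g * ((∏ i, (a i).factorial : ℕ) * coeff a f) := by
  conv_lhs => rw [g.as_sum, map_sum]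
  refine Finset.sum_congr rfl fun a _ => ?_
  rw [← mul_one (coeff a g), ← smul_eq_mul, ← smul_monomial, map_smul, pairing_monomial]
  simp

/-- Multiplication by x_i is adjoint to ∂_i; the factorials in the pairing are there for this. -/
theorem pairing_X_mul (f g : MvPolynomial (Fin n) F) (i : Fin n) :
    pairing f (X i * g) = pairing (pderiv i f) g := by
  suffices h : pairing f ∘ₗ LinearMap.mulLeft F (X i) = pairing (pderiv i f) from
    LinearMap.congr_fun h g
  refine (basisMonomials (Fin n) F).ext fun a => ?_
  rw [coe_basisMonomials, LinearMap.comp_apply, LinearMap.mulLeft_apply, pairing_monomial,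
    coeff_pderiv, X, monomial_mul, one_mul, pairing_monomial, add_comm (Finsupp.single i 1) a,
    ← Finset.mul_prod_erase _ (fun j => ((a + Finsupp.single i 1 : Fin n →₀ ℕ) j).factorial)
      (Finset.mem_univ i),
    ← Finset.mul_prod_erase _ (fun j => (a j).factorial) (Finset.mem_univ i)]
  have h : ∏ j ∈ Finset.univ.erase i, ((a + Finsupp.single i 1 : Fin n →₀ ℕ) j).factorial =
      ∏ j ∈ Finset.univ.erase i, (a j).factorial := by
    refine Finset.prod_congr rfl fun j hj => ?_
    rw [Finsupp.add_apply, Finsupp.single_eq_of_ne (Finset.ne_of_mem_erase hj), add_zero]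
  rw [h, Finsupp.add_apply, Finsupp.single_eq_same, Nat.factorial_succ]
  push_cast
  ring

theorem pairing_eq_zero_of_mem_oneRowIdeal {d : Fin n → ℕ} {f : MvPolynomial (Fin n) F}
    (hdeg : ∀ i, degreeOf i f ≤ d i) (hf : ∑ i, pderiv i f = 0) {g : MvPolynomial (Fin n) F}
    (hg : g ∈ oneRowIdeal F d) : pairing f g = 0 := by
  have key : ∀ x ∈ Set.range (fun i : Fin n => (X i : MvPolynomial (Fin n) F) ^ (d i + 1)) ∪
      {∑ i : Fin n, X i}, ∀ a, pairing f (a * x) = 0 := by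
    rintro x (⟨i, rfl⟩ | rfl) a
    · suffices h : pairing f ∘ₗ LinearMap.mulRight F (X i ^ (d i + 1)) = 0 from
        LinearMap.congr_fun h a
      refine (basisMonomials (Fin n) F).ext fun b => ?_
      rw [coe_basisMonomials, LinearMap.comp_apply, LinearMap.mulRight_apply, X_pow_eq_monomial,
        monomial_mul, one_mul, pairing_monomial, LinearMap.zero_apply]
      refine mul_eq_zero_of_right _ ?_
      by_contra h
      have h1 := (monomial_le_degreeOf i (mem_support_iff.mpr h)).trans (hdeg i)
      rw [Finsupp.add_apply, Finsupp.single_eq_same] at h1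
      omega
    · rw [Finset.mul_sum, map_sum]
      simp only [mul_comm a, pairing_X_mul]
      simp only [pairing_apply]
      rw [Finset.sum_comm]
      refine Finset.sum_eq_zero fun b _ => ?_
      rw [← Finset.mul_sum, ← Finset.mul_sum, ← coeff_sum, hf, coeff_zero, mul_zero, mul_zero]
  induction hg using Submodule.span_induction with
  | mem x hx => simpa using key x hx 1
  | zero => simp
  | add x y _ _ hx hy => rw [map_add, hx, hy, add_zero]
  | smul a x hx' hx =>
    clear hx
    induction hx' using Submodule.span_induction generalizing a with
    | mem x hx => exact key x hx a
    | zero => simp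
    | add x y _ _ hx hy => rw [smul_add, map_add, hx a, hy a, add_zero]
    | smul b x _ hx => rw [smul_smul]; exact hx _

/-- The lexicographically smallest monomial of `f` is `x ^ e`. -/
def HasTrailingExponent (f : MvPolynomial (Fin n) F) (e : Fin n →₀ ℕ) : Prop :=
  coeff e f ≠ 0 ∧ ∀ a, toLex a < toLex e → coeff a f = 0

theorem HasTrailingExponent.mul {f g : MvPolynomial (Fin n) F} {a b : Fin n →₀ ℕ}
    (hf : HasTrailingExponent f a) (hg : HasTrailingExponent g b) :
    HasTrailingExponent (f * g) (a + b) := by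
  classical
  constructor
  · rw [coeff_mul, Finset.sum_eq_single (a, b)]
    · exact mul_ne_zero hf.1 hg.1
    · rintro ⟨a', b'⟩ hab hne
      rw [Finset.HasAntidiagonal.mem_antidiagonal] at hab
      have hab' : toLex a' + toLex b' = toLex a + toLex b := congrArg toLex hab
      rcases lt_trichotomy (toLex a') (toLex a) with h | h | h
      · rw [hf.2 _ h, zero_mul]
      · obtain rfl : a' = a := toLex.injective h
        obtain rfl : b' = b := add_left_cancel hab
        exact absurd rfl hne
      · have : toLex b' < toLex b := by
          by_contra hb
          exact (add_lt_add_of_lt_of_le h (not_lt.mp hb)).ne' hab'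
        rw [hg.2 _ this, mul_zero]
    · intro h
      rw [Finset.HasAntidiagonal.mem_antidiagonal] at h
      exact absurd rfl h
  · intro c hc
    rw [coeff_mul]
    refine Finset.sum_eq_zero ?_
    rintro ⟨a', b'⟩ hab
    rw [Finset.HasAntidiagonal.mem_antidiagonal] at hab
    have hab' : toLex a' + toLex b' < toLex a + toLex b := by
      have : toLex a' + toLex b' = toLex c := congrArg toLex hab
      rw [this]
      exact hc
    rcases lt_or_lt_of_add_lt_add hab' with h | h
    · rw [hf.2 _ h, zero_mul]
    · rw [hg.2 _ h, mul_zero]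

theorem hasTrailingExponent_X_sub_X {i j : Fin n} (hij : i < j) :
    HasTrailingExponent (X j - X i : MvPolynomial (Fin n) F) (Finsupp.single j 1) := by
  classical
  have hlt : toLex (Finsupp.single j 1 : Fin n →₀ ℕ) < toLex (Finsupp.single i 1) :=
    Finsupp.Lex.single_lt_iff.mpr hij
  constructor
  · rw [coeff_sub, coeff_X, coeff_X, if_pos rfl, if_neg (fun h => hlt.ne' (congrArg toLex h)),
      sub_zero]
    exact one_ne_zero
  · intro a ha
    rw [coeff_sub, coeff_X, coeff_X, if_neg (fun h => ha.ne' (congrArg toLex h)),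
      if_neg (fun h => (ha.trans hlt).ne' (congrArg toLex h)), sub_zero]

theorem hasTrailingExponent_prod {ι : Type*} (s : Finset ι) (f : ι → MvPolynomial (Fin n) F)
    (e : ι → Fin n →₀ ℕ) (h : ∀ c ∈ s, HasTrailingExponent (f c) (e c)) :
    HasTrailingExponent (∏ c ∈ s, f c) (∑ c ∈ s, e c) := by
  classical
  induction s using Finset.induction_on with
  | empty =>
    refine ⟨by simp, fun a ha => ?_⟩
    rw [Finset.prod_empty, coeff_one, if_neg]
    rintro rfl
    exact ha.false
  | insert c s hc ih =>
    rw [Finset.prod_insert hc, Finset.sum_insert hc]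
    exact (h c (Finset.mem_insert_self _ _)).mul
      (ih fun c hc => h c (Finset.mem_insert_of_mem hc))

/-- Differences of variables are invariant under simultaneous translation, whose infinitesimal
generator is ∑ ∂_i. -/
theorem sum_pderiv_prod_X_sub_X {ι : Type*} (s : Finset ι) (p q : ι → Fin n) :
    ∑ i, pderiv i (∏ c ∈ s, (X (q c) - X (p c) : MvPolynomial (Fin n) F)) = 0 := by
  classical
  induction s using Finset.induction_on with
  | empty => simp
  | insert c s hc ih =>
    simp only [Finset.prod_insert hc, pderiv_mul]
    rw [Finset.sum_add_distrib, ← Finset.sum_mul, ← Finset.mul_sum, ih, mul_zero, add_zero]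
    simp [pderiv_X, Pi.single_apply, Finset.sum_sub_distrib]

theorem sum_single_mem_standardMonomials [CharZero F] {ι : Type*} [Fintype ι] {d : Fin n → ℕ}
    {p q : ι → Fin n} (hpq : ∀ c, p c < q c)
    (hd : ∀ i, (Finset.univ.filter fun c => p c = i).card +
      (Finset.univ.filter fun c => q c = i).card ≤ d i) :
    ∑ c, Finsupp.single (q c) 1 ∈ standardMonomials MonomialOrder.lex (oneRowIdeal F d) := by
  classical
  set f : MvPolynomial (Fin n) F := ∏ c, (X (q c) - X (p c)) with hf
  have htrail : HasTrailingExponent f (∑ c, Finsupp.single (q c) 1) :=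
    hasTrailingExponent_prod _ _ _ fun c _ => hasTrailingExponent_X_sub_X (hpq c)
  have hdeg (i : Fin n) : degreeOf i f ≤ d i := by
    refine (degreeOf_prod_le i _ _).trans (le_trans (Finset.sum_le_sum
      (g := fun c => (if p c = i then 1 else 0) + if q c = i then 1 else 0) fun c _ => ?_) ?_)
    · refine (degreeOf_sub_le i _ _).trans ?_
      rw [degreeOf_X, degreeOf_X]
      simp only [eq_comm (a := i)]
      split_ifs <;> simp
    · rw [Finset.sum_add_distrib, ← Finset.card_filter, ← Finset.card_filter]
      exact hd i
  refine mem_standardMonomials_of_forall _ _ fun g hg hg0 hge => ?_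
  have h0 : pairing f g = 0 :=
    pairing_eq_zero_of_mem_oneRowIdeal hdeg (sum_pderiv_prod_X_sub_X _ p q) hg
  -- All other monomials of g lie below x^e, where f has no terms. In characteristic zero the
  -- factorials in the surviving term are nonzero.
  rw [pairing_apply, Finset.sum_eq_single (MonomialOrder.lex.degree g)] at h0
  · refine mul_ne_zero (MonomialOrder.lex.coeff_degree_ne_zero_iff.mpr hg0)
      (mul_ne_zero ?_ (hge ▸ htrail.1)) h0
    exact Nat.cast_ne_zero.mpr (Finset.prod_ne_zero_iff.mpr fun i _ => Nat.factorial_ne_zero _)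
  · intro a ha hne
    have hlt : toLex a < toLex (∑ c, Finsupp.single (q c) 1) := by
      rw [← hge]
      exact lt_of_le_of_ne (MonomialOrder.lex.le_degree ha) fun h => hne (toLex.injective h)
    rw [htrail.2 a hlt, mul_zero, mul_zero]
  · intro h
    exact absurd (MonomialOrder.lex.degree_mem_support hg0) h

end InverseSystem

/-! ### From ballot exponents to tableaux, and from tableaux to standard monomials -/

section Tableaux

variable {n : ℕ}

theorem mem_twoRowRectangle {m r c : ℕ} : (r, c) ∈ twoRowRectangle m ↔ r < 2 ∧ c < m := by
  rw [← YoungDiagram.mem_cells]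
  simp [twoRowRectangle]

theorem copiesInRow_eq {m : ℕ} (T : SemistandardYoungTableau (twoRowRectangle m)) {r : ℕ}
    (hr : r < 2) (a : ℕ) :
    copiesInRow T r a = ((Finset.range m).filter fun c => T r c = a).card := by
  rw [copiesInRow]
  symm
  refine Finset.card_nbij' (fun c => (r, c)) Prod.snd ?_ ?_ ?_ ?_
  · intro c hc
    simp only [Finset.coe_filter, Finset.mem_range, Set.mem_ofPred_eq] at hc ⊢
    exact ⟨YoungDiagram.mk_mem_row_iff.mpr (mem_twoRowRectangle.mpr ⟨hr, hc.1⟩), hc.2⟩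
  · rintro ⟨r', c⟩ hc
    simp only [Finset.coe_filter, Set.mem_ofPred_eq, YoungDiagram.mem_row_iff,
      mem_twoRowRectangle, Finset.mem_range] at hc ⊢
    obtain ⟨⟨⟨-, h⟩, rfl⟩, h'⟩ := hc
    exact ⟨h, h'⟩
  · intro c _
    rfl
  · rintro ⟨r', c⟩ hc
    simp only [Finset.coe_filter, Set.mem_ofPred_eq, YoungDiagram.mem_row_iff] at hc
    exact Prod.ext hc.1.2.symm rfl

theorem copies_eq {m : ℕ} (T : SemistandardYoungTableau (twoRowRectangle m)) (a : ℕ) :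
    copies T a = copiesInRow T 0 a + copiesInRow T 1 a := by
  rw [copiesInRow_eq T zero_lt_two, copiesInRow_eq T one_lt_two, copies, Finset.card_filter,
    Finset.card_filter, Finset.card_filter]
  change ∑ i ∈ Finset.range 2 ×ˢ Finset.range m, _ = _
  rw [Finset.sum_product, Finset.sum_range_succ, Finset.sum_range_one]

/-- The number of the step in which the partial sums `E` first exceed `c`. -/
noncomputable def firstExceeding (E : ℕ → ℕ) (c : ℕ) : ℕ :=
  sInf {k | c < E k}

theorem firstExceeding_le {E : ℕ → ℕ} {c k : ℕ} (h : c < E k) : firstExceeding E c ≤ k :=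
  Nat.sInf_le h

theorem lt_firstExceeding {E : ℕ → ℕ} {c k : ℕ} (h : c < E k) : c < E (firstExceeding E c) :=
  Nat.sInf_mem (s := {k | c < E k}) ⟨k, h⟩

theorem firstExceeding_mono {E : ℕ → ℕ} {c c' k : ℕ} (hc : c ≤ c') (h : c' < E k) :
    firstExceeding E c ≤ firstExceeding E c' :=
  firstExceeding_le (hc.trans_lt (lt_firstExceeding h))

theorem firstExceeding_pos {E : ℕ → ℕ} (h0 : E 0 = 0) {c k : ℕ} (h : c < E k) :
    0 < firstExceeding E c := by
  rw [Nat.pos_iff_ne_zero]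
  intro h1
  have := lt_firstExceeding h
  rw [h1, h0] at this
  omega

theorem firstExceeding_eq_succ_iff {E : ℕ → ℕ} (hE : Monotone E) {c k : ℕ} :
    firstExceeding E c = k + 1 ↔ E k ≤ c ∧ c < E (k + 1) := by
  constructor
  · intro h
    refine ⟨?_, ?_⟩
    · by_contra hc
      have := firstExceeding_le (not_le.mp hc)
      omega
    · have hne : {k | c < E k}.Nonempty := by
        by_contra hne
        rw [Set.not_nonempty_iff_eq_empty] at hne
        rw [firstExceeding, hne, Nat.sInf_empty] at h
        omega
      have := Nat.sInf_mem hne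
      rwa [← firstExceeding, h] at this
  · rintro ⟨h1, h2⟩
    refine le_antisymm (firstExceeding_le h2) (Nat.succ_le_of_lt ?_)
    by_contra hk
    have := hE (not_lt.mp hk)
    have := lt_firstExceeding h2
    omega

/-- The partial sums of a finite sequence. -/
def partialSum (e : Fin n → ℕ) (k : ℕ) : ℕ :=
  ∑ j : Fin n with j.val < k, e j

theorem partialSum_zero (e : Fin n → ℕ) : partialSum e 0 = 0 := by
  simp [partialSum]

theorem partialSum_mono (e : Fin n → ℕ) : Monotone (partialSum e) := fun _ _ h =>
  Finset.sum_le_sum_of_subset (Finset.monotone_filter_right _ fun _ _ hj => lt_of_lt_of_le hj h)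

theorem partialSum_val (e : Fin n → ℕ) (i : Fin n) :
    partialSum e i = ∑ j ∈ Finset.Iio i, e j := by
  rw [partialSum]
  congr 1
  ext j
  simp

theorem partialSum_val_succ (e : Fin n → ℕ) (i : Fin n) :
    partialSum e (i + 1) = partialSum e i + e i := by
  have h : (Finset.univ.filter fun j : Fin n => j.val < i + 1) =
      insert i (Finset.univ.filter fun j : Fin n => j.val < i) := by
    ext j
    simp only [Finset.mem_filter, Finset.mem_univ, true_and, Finset.mem_insert, Fin.ext_iff]
    omega
  rw [partialSum, h, Finset.sum_insert (by simp), partialSum, add_comm]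

theorem partialSum_add (e f : Fin n → ℕ) (k : ℕ) :
    partialSum (e + f) k = partialSum e k + partialSum f k :=
  Finset.sum_add_distrib

theorem card_filter_firstExceeding_le {E : ℕ → ℕ} (hE : Monotone E) (m k : ℕ) :
    ((Finset.range m).filter fun c => firstExceeding E c = k + 1).card ≤ E (k + 1) - E k := by
  rw [← Nat.card_Ico]
  refine Finset.card_le_card fun c hc => ?_
  rw [Finset.mem_filter, firstExceeding_eq_succ_iff hE] at hc
  exact Finset.mem_Ico.mpr hc.2

theorem card_filter_firstExceeding {E : ℕ → ℕ} (hE : Monotone E) {m k : ℕ} (hm : E (k + 1) ≤ m) :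
    ((Finset.range m).filter fun c => firstExceeding E c = k + 1).card = E (k + 1) - E k := by
  rw [← Nat.card_Ico]
  congr 1
  ext c
  rw [Finset.mem_filter, firstExceeding_eq_succ_iff hE, Finset.mem_Ico, Finset.mem_range]
  omega

/-- The two-row rectangular tableau with prescribed rows. -/
def twoRowTableau (m : ℕ) (u v : ℕ → ℕ) (hu : ∀ c c', c < c' → c' < m → u c ≤ u c')
    (hv : ∀ c c', c < c' → c' < m → v c ≤ v c') (huv : ∀ c < m, u c < v c) :
    SemistandardYoungTableau (twoRowRectangle m) where
  entry r c := if r < 2 ∧ c < m then (if r = 0 then u c else v c) else 0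
  row_weak' {r c c'} h hc := by
    rw [mem_twoRowRectangle] at hc
    rw [if_pos hc, if_pos ⟨hc.1, h.trans hc.2⟩]
    split_ifs
    exacts [hu _ _ h hc.2, hv _ _ h hc.2]
  col_strict' {r r' c} h hc := by
    rw [mem_twoRowRectangle] at hc
    rw [if_pos hc, if_pos ⟨h.trans hc.1, hc.2⟩, if_pos (by omega), if_neg (by omega)]
    exact huv c hc.2
  zeros' h := if_neg (mt mem_twoRowRectangle.mpr h)

theorem IsBallot.mem_secondRowExponents {d : Fin n → ℕ} {e : Fin n →₀ ℕ} (he : IsBallot d e) :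
    e ∈ secondRowExponents d := by
  set E := partialSum e with hE
  set G := partialSum (d - ⇑e) with hG
  have hEm : Monotone E := partialSum_mono _
  have hGm : Monotone G := partialSum_mono _
  have hEn (i : Fin n) : E (i + 1) ≤ E n := hEm i.2
  -- The ballot inequality in partial sums: the letters up to i + 1 in the second row are no more
  -- numerous than the letters up to i available for the first, which forces strict columns.
  have hGE (i : Fin n) : E (i + 1) ≤ G i := by
    have h1 := (he i).2
    have h2 : (d - ⇑e) + ⇑e = d := tsub_add_cancel_of_le fun i => (he i).1
    have h3 := partialSum_add (d - ⇑e) e i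
    rw [h2, partialSum_val d, ← hE, ← hG] at h3
    rw [← partialSum_val e, ← hE] at h1
    rw [hE, partialSum_val_succ, ← hE]
    omega
  have hstep {c : ℕ} (hc : c < E n) : ∃ i : Fin n, firstExceeding E c = i + 1 ∧ c < G i := by
    have h1 := firstExceeding_le hc
    obtain ⟨k, hk⟩ : ∃ k, firstExceeding E c = k + 1 := Nat.exists_eq_add_one_of_ne_zero
      (firstExceeding_pos (partialSum_zero _) hc).ne'
    have h2 := ((firstExceeding_eq_succ_iff hEm).mp hk).2
    have hkn : k < n := by omega
    exact ⟨⟨k, hkn⟩, hk, h2.trans_le (hGE ⟨k, hkn⟩)⟩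
  let T := twoRowTableau (E n) (firstExceeding G) (firstExceeding E)
    (fun c c' h hc' => by
      obtain ⟨i, -, hi⟩ := hstep hc'
      exact firstExceeding_mono h.le hi)
    (fun c c' h hc' => firstExceeding_mono h.le hc')
    (fun c hc => by
      obtain ⟨i, hi, hi'⟩ := hstep hc
      rw [hi]
      exact Nat.lt_succ_of_le (firstExceeding_le hi'))
  have hT0 {c : ℕ} (hc : c < E n) : T 0 c = firstExceeding G c := by
    change (if 0 < 2 ∧ c < E n then (if 0 = 0 then _ else _) else 0) = _
    rw [if_pos ⟨zero_lt_two, hc⟩, if_pos rfl]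
  have hT1 {c : ℕ} (hc : c < E n) : T 1 c = firstExceeding E c := by
    change (if 1 < 2 ∧ c < E n then (if 1 = 0 then _ else _) else 0) = _
    rw [if_pos ⟨one_lt_two, hc⟩, if_neg one_ne_zero]
  -- Only an inequality, since the sorted content d - e is cut off at the length of the second row.
  have hrow0 (i : Fin n) : copiesInRow T 0 (i + 1) ≤ d i - e i := by
    rw [copiesInRow_eq T zero_lt_two, Finset.filter_congr (q := fun c => firstExceeding G c = i + 1)
      fun c hc => by rw [hT0 (Finset.mem_range.mp hc)]]
    refine (card_filter_firstExceeding_le hGm _ _).trans ?_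
    rw [hG, partialSum_val_succ, Nat.add_sub_cancel_left]
    rfl
  have hrow1 (i : Fin n) : copiesInRow T 1 (i + 1) = e i := by
    rw [copiesInRow_eq T one_lt_two, Finset.filter_congr (q := fun c => firstExceeding E c = i + 1)
      fun c hc => by rw [hT1 (Finset.mem_range.mp hc)], card_filter_firstExceeding hEm (hEn i),
      hE, partialSum_val_succ, Nat.add_sub_cancel_left]
  refine ⟨E n, T, ⟨?_, fun i => ?_⟩, fun i => (hrow1 i).symm⟩
  · rintro ⟨r, c⟩ hrc
    obtain ⟨hr, hc⟩ := mem_twoRowRectangle.mp hrc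
    obtain ⟨i, hi, hi'⟩ := hstep hc
    have hin := i.2
    interval_cases r
    · change 1 ≤ T 0 c ∧ T 0 c ≤ n
      rw [hT0 hc]
      exact ⟨firstExceeding_pos (partialSum_zero _) hi',
        (firstExceeding_le hi').trans hin.le⟩
    · change 1 ≤ T 1 c ∧ T 1 c ≤ n
      rw [hT1 hc, hi]
      omega
  · have h1 := hrow0 i
    have h2 := (he i).1
    rw [copies_eq, hrow1]
    omega

theorem secondRowExponents_subset_standardMonomials {F : Type*} [Field F] [CharZero F]
    (d : Fin n → ℕ) :
    secondRowExponents d ⊆ standardMonomials MonomialOrder.lex (oneRowIdeal F d) := by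
  rintro e ⟨m, T, ⟨hT, hd⟩, he⟩
  have hletter (r : ℕ) (hr : r < 2) (c : Fin m) : ∃ i : Fin n, T r c = i + 1 := by
    obtain ⟨h1, h2⟩ := hT (r, c) (mem_twoRowRectangle.mpr ⟨hr, c.2⟩)
    exact ⟨⟨T r c - 1, by dsimp only at h1 h2; omega⟩, by dsimp only at h1 ⊢; omega⟩
  have hcard (r : ℕ) (hr : r < 2) (p : Fin m → Fin n) (hp : ∀ c : Fin m, T r c = p c + 1)
      (i : Fin n) : (Finset.univ.filter fun c => p c = i).card = copiesInRow T r (i + 1) := by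
    rw [copiesInRow_eq T hr, Finset.card_filter, Finset.card_filter, Finset.sum_range]
    refine Finset.sum_congr rfl fun c _ => ?_
    simp [hp, Fin.ext_iff]
  choose p hp using hletter 0 zero_lt_two
  choose q hq using hletter 1 one_lt_two
  have hsum : e = ∑ c, Finsupp.single (q c) 1 := by
    ext i
    rw [he, ← hcard 1 one_lt_two q hq, Finset.card_filter, Finsupp.finsetSum_apply]
    simp [Finsupp.single_apply]
  rw [hsum]
  refine sum_single_mem_standardMonomials (p := p) (fun c => ?_) fun i => ?_
  · have := T.col_strict zero_lt_one (mem_twoRowRectangle.mpr ⟨one_lt_two, c.2⟩)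
    rw [hp, hq] at this
    exact Fin.lt_def.mpr (by omega)
  · rw [hcard 0 zero_lt_two p hp, hcard 1 one_lt_two q hq, ← copies_eq]
    exact hd i

end Tableaux

end OneRow

theorem mainTheorem5 (F : Type*) [Field F] [CharZero F] (n : ℕ) (d : Fin n → ℕ) :
    OneRow.standardMonomials MonomialOrder.lex (OneRow.oneRowIdeal F d) =
        OneRow.secondRowExponents d ∧
      LinearIndependent F (fun e : OneRow.secondRowExponents d =>
        (Ideal.Quotient.mk (OneRow.oneRowIdeal F d) (MvPolynomial.monomial e.1 1) :
          OneRow.OneRowRing F d)) ∧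
      Submodule.span F (Set.range (fun e : OneRow.secondRowExponents d =>
        (Ideal.Quotient.mk (OneRow.oneRowIdeal F d) (MvPolynomial.monomial e.1 1) :
          OneRow.OneRowRing F d))) = ⊤ := by
  have hstd := OneRow.secondRowExponents_subset_standardMonomials (F := F) d
  have hspan : Submodule.span F ((fun e : Fin n →₀ ℕ => MvPolynomial.monomial e (1 : F)) ''
      OneRow.secondRowExponents d) ⊔ (OneRow.oneRowIdeal F d).restrictScalars F = ⊤ :=
    eq_top_mono (sup_le_sup_right (Submodule.span_mono (Set.image_mono fun _ he =>
      OneRow.IsBallot.mem_secondRowExponents he)) _) (OneRow.span_ballot_sup_oneRowIdeal d)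
  exact ⟨OneRow.standardMonomials_eq_of_span hstd hspan,
    OneRow.linearIndependent_of_subset_standardMonomials hstd, OneRow.span_range_mk_eq_top hspan⟩
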